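/- **Theorem (shifted $M/M/\infty$ representation of the fluid MGF).** Let $c\ge 1$ be an integer, $\mu,\theta>0$, and let $\lambda:[0,\infty)\to\mathbb R$ be locally integrable with $\inf_{t\ge0}\lambda(t)>c\mu$. Let $q(0)>c$ and $\gamma=\frac{c(\theta-\mu)}{\theta}$. For an interval $I\ni 0$, a *fluid MGF on $I$* of the Erlang-A queue (arrival rate $\lambda(t)$, $c$ servers, service rate $\mu$, abandonment rate $\theta$, initial value $q(0)$) is a function $M_f(t,\alpha)$, $t\ge0$, $\alpha\in I$, which is continuous with continuous derivative in $\alpha$ and solves $$\frac{\partial M_f}{\partial t}=\lambda(t)(e^\alpha-1)M_f+\theta(e^{-\alpha}-1)\frac{\partial M_f}{\partial\alpha}-(\theta-\mu)(e^{-\alpha}-1)\Big(\frac{\partial M_f}{\partial\alpha}\wedge c\,M_f\Big),\qquad M_f(0,\alpha)=e^{\alpha q(0)} .$$ The *MGF $N(t,\alpha)$ of the $M/M/\infty$ queue* with arrival rate $\lambda(t)$, service rate $\theta$ and real initial value $x_0$ is the solution, in the same sense with $I=\mathbb R$, of $$\frac{\partial N}{\partial t}=\lambda(t)(e^\alpha-1)N+\theta(e^{-\alpha}-1)\frac{\partial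 N}{\partial\alpha},\qquad N(0,\alpha)=e^{\alpha x_0}.$$ Both equations are understood integrated in $t$ (for continuous $\lambda$ this is the classical sense). Take $x_0=q(0)-\gamma$. Then: 1. $N$ exists and is unique. If $x_0=n_0$ is a non-negative integer, then $N(t,\alpha)=\mathbb E[e^{\alpha Q_\infty(t)}]<\infty$ for all $t\ge0$, $\alpha\in\mathbb R$, whenever the laws of $Q_\infty(t)$, $t\ge 0$, on $\{0,1,2,\dots\}$ have time-continuous point probabilities, start at $Q_\infty(0)=n_0$ and satisfy the (integrated) Kolmogorov forward equations with birth rate $\lambda(t)$ and death rate $\theta n$ in state $n$. 2. There is $\delta>0$ such that $e^{\alpha\gamma}N(t,\alpha)$ is a fluid MGF on $(-\delta,\infty)$, and every fluid MGF $M_f$ on any interval $I\ni0$ satisfies $$M_f(t,\alpha)=e^{\alpha\gamma}N(t,\alpha)\qquad\text{for all } t\ge0,\ \alpha\in I,\ \alpha>-\delta .$$ That is, in a neighbourhood of $0$ and for all $\alpha\ge 0$, the fluid MGF is the MGF of the $M/M/\infty$ queue with arrival rate $\lambda(t)$, service rate $\theta$ and initial value $q(0)-\gamma$, shifted by $\gamma$.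 3. If a fluid MGF on some interval $I\ni 0$ of positive length is there the MGF of real random variables $Q_f(t)$, $t\ge 0$, with $\mathbb E[e^{\alpha Q_f(t)}]<\infty$ for all $\alpha\in\mathbb R$, then $\mathbb E[e^{\alpha Q_f(t)}]=e^{\alpha\gamma}N(t,\alpha)$ for all $t\ge0$ and all $\alpha\in\mathbb R$; and if moreover $q(0)-\gamma=n_0$ is an integer, then $Q_f(t)$ has the law of $Q_\infty(t)+\gamma$, with $Q_\infty$ as in 1. -/

import Mathlib

open MeasureTheory ProbabilityTheory Set

/-- `IsFluidMGF lam c μ θ q₀ I M`: on `t ≥ 0`, `α ∈ I`, the function `M t α` is a fluid approximation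
of the moment generating function of the Erlang-A queue with arrival rate `lam`, `c` servers,
service rate `μ`, abandonment rate `θ` and initial value `q₀`, i.e. a solution of
`∂M/∂t = lam(t) (e^α - 1) M + θ (e^{-α} - 1) ∂M/∂α - (θ - μ) (e^{-α} - 1) min (∂M/∂α) (c M)`,
`M 0 α = e^{α q₀}`.
`M` and `D = ∂M/∂α` are jointly continuous and the equation is integrated in time, so that the
arrival rate only has to be locally integrable; where `lam` is continuous this is the equation with
the classical time derivative. -/
def IsFluidMGF (lam : ℝ → ℝ) (c μ θ q₀ : ℝ) (I : Set ℝ) (M : ℝ → ℝ → ℝ) : Prop :=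
  ∃ D : ℝ → ℝ → ℝ,
    ContinuousOn (Function.uncurry M) (Ici 0 ×ˢ I) ∧
    ContinuousOn (Function.uncurry D) (Ici 0 ×ˢ I) ∧
    (∀ t, 0 ≤ t → ∀ α ∈ I, HasDerivWithinAt (M t) (D t α) I α) ∧
    (∀ t, 0 ≤ t → ∀ α ∈ I,
      M t α = Real.exp (α * q₀) +
        ∫ s in (0 : ℝ)..t,
          (lam s * (Real.exp α - 1) * M s α + θ * (Real.exp (-α) - 1) * D s α
            - (θ - μ) * (Real.exp (-α) - 1) * min (D s α) (c * M s α)))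

/-- `IsMMInfMGF lam θ x₀ N`: `N t α` (`t ≥ 0`, `α ∈ ℝ`) is the moment generating function of the
`M/M/∞` queue with arrival rate `lam`, service rate `θ` and (real) initial value `x₀`, i.e. the
solution of the forward equation
`∂N/∂t = lam(t) (e^α - 1) N + θ (e^{-α} - 1) ∂N/∂α`, `N 0 α = e^{α x₀}`. -/
def IsMMInfMGF (lam : ℝ → ℝ) (θ x₀ : ℝ) (N : ℝ → ℝ → ℝ) : Prop :=
  ∃ D : ℝ → ℝ → ℝ,
    ContinuousOn (Function.uncurry N) (Ici 0 ×ˢ univ) ∧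
    ContinuousOn (Function.uncurry D) (Ici 0 ×ˢ univ) ∧
    (∀ t, 0 ≤ t → ∀ α, HasDerivAt (N t) (D t α) α) ∧
    (∀ t, 0 ≤ t → ∀ α,
      N t α = Real.exp (α * x₀) +
        ∫ s in (0 : ℝ)..t,
          (lam s * (Real.exp α - 1) * N s α + θ * (Real.exp (-α) - 1) * D s α))

/-- `IsMMInfLaw lam θ n₀ P`: `P t` (`t ≥ 0`) is the law at time `t` of the `M/M/∞` queue with arrival
rate `lam`, service rate `θ` per customer and `n₀` customers at time `0`: probability measures on
`ℕ` that start at `δ_{n₀}` and satisfy the Kolmogorov forward equations of the birth-death chain with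
birth rate `lam(t)` and death rate `θ n` in state `n`. -/
structure IsMMInfLaw (lam : ℝ → ℝ) (θ : ℝ) (n₀ : ℕ) (P : ℝ → Measure ℕ) : Prop where
  prob : ∀ t, 0 ≤ t → IsProbabilityMeasure (P t)
  init : P 0 = Measure.dirac n₀
  cont : ∀ n : ℕ, ContinuousOn (fun t => (P t).real {n}) (Ici 0)
  forward : ∀ t, 0 ≤ t → ∀ n : ℕ,
    (P t).real {n} = (P 0).real {n} +
      ∫ s in (0 : ℝ)..t,
        (lam s * ((if n = 0 then 0 else (P s).real {n - 1}) - (P s).real {n})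
          + θ * (((n : ℝ) + 1) * (P s).real {n + 1} - (n : ℝ) * (P s).real {n}))

/-!
Multiplying a solution by `e^{-(e^α - 1) ∫₀ᵗ lam}` removes the arrival term. As `d ∧ c m` is a
Lipschitz function of `(m, d)`, the positive part of the difference of two gauged fluid MGFs then
satisfies a transport inequality whose velocity is a non-negative multiple of `e^{-α} - 1`. This
velocity points towards `0`, so on a compact interval containing `0` there is no inflow through the
boundary and the maximum principle gives uniqueness; `θ = μ` is the case of the `M/M/∞` queue.

The `M/M/∞` queue has an explicit MGF `N`, a Poisson factor for the arrivals times the `x₀`-th power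
of the MGF of a Bernoulli variable. The choice of `γ` means `θ (c - γ) = c μ`, so both the arrivals
(`lam > c μ`) and the initial value (`q₀ > c`) keep `∂ log N / ∂α` above `c - γ` for `α > -δ`. There
the minimum in the fluid equation of `M = e^{αγ} N` is always `c M`, which makes the fluid equation
for `M` the `M/M/∞` equation for `N`.

A law solving the forward equations is paired with the explicit solution of the backward equations
with terminal value `z ^ n`. For `0 ≤ z < 1` that solution decays geometrically in `n`, so the
pairing is constant in time, which computes the generating function there; it is entire, so the
power series represents it for every `z`. Equality of MGFs near `0` extends by analyticity.
-/

open Filter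
open scoped Topology

/-! ### Absolutely continuous functions -/

theorem absolutelyContinuousOnInterval_congr {X : Type*} [PseudoMetricSpace X] {f g : ℝ → X}
    {a b : ℝ} (hf : AbsolutelyContinuousOnInterval f a b) (h : EqOn g f (uIcc a b)) :
    AbsolutelyContinuousOnInterval g a b := by
  rw [absolutelyContinuousOnInterval_iff] at hf ⊢
  intro ε hε
  obtain ⟨δ, hδ, H⟩ := hf ε hε
  refine ⟨δ, hδ, fun E hE hlt => (Finset.sum_congr rfl fun i hi => ?_).trans_lt (H E hE hlt)⟩
  rw [h (hE.1 i hi).1, h (hE.1 i hi).2]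

theorem absolutelyContinuousOnInterval_comp_of_lipschitzOnWith {X Y : Type*}
    [PseudoMetricSpace X] [PseudoMetricSpace Y] {f : ℝ → X} {φ : X → Y} {a b : ℝ} {s : Set X}
    {K : NNReal} (hφ : LipschitzOnWith K φ s) (hf : AbsolutelyContinuousOnInterval f a b)
    (hs : MapsTo f (uIcc a b) s) : AbsolutelyContinuousOnInterval (φ ∘ f) a b := by
  rw [absolutelyContinuousOnInterval_iff] at hf ⊢
  intro ε hε
  obtain ⟨δ, hδ, H⟩ := hf (ε / (K + 1)) (by positivity)
  refine ⟨δ, hδ, fun E hE hlt => ?_⟩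
  calc _ ≤ ∑ i ∈ Finset.range E.1, K * dist (f (E.2 i).1) (f (E.2 i).2) :=
        Finset.sum_le_sum fun i hi =>
          hφ.dist_le_mul _ (hs (hE.1 i hi).1) _ (hs (hE.1 i hi).2)
    _ = K * ∑ i ∈ Finset.range E.1, dist (f (E.2 i).1) (f (E.2 i).2) := by rw [Finset.mul_sum]
    _ ≤ K * (ε / (K + 1)) := by gcongr; exact (H E hE hlt).le
    _ < (K + 1) * (ε / (K + 1)) := by gcongr; exact lt_add_one _
    _ = ε := by field_simp

/-- `HasACDerivOn f f' a b`: `f` is absolutely continuous on the interval between `a` and `b`, and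
`f'` is its derivative almost everywhere there. For equations integrated in time it plays the role
that `HasDerivAt` plays for classical ones. -/
def HasACDerivOn (f f' : ℝ → ℝ) (a b : ℝ) : Prop :=
  AbsolutelyContinuousOnInterval f a b ∧ ∀ᵐ x, x ∈ uIcc a b → HasDerivAt f (f' x) x

namespace HasACDerivOn

variable {f f' g g' φ φ' : ℝ → ℝ} {a b : ℝ}

theorem congr_deriv (hf : HasACDerivOn f f' a b) (h : EqOn f' g' (uIcc a b)) :
    HasACDerivOn f g' a b :=
  ⟨hf.1, by filter_upwards [hf.2] with x hx hxab using h hxab ▸ hx hxab⟩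

theorem add (hf : HasACDerivOn f f' a b) (hg : HasACDerivOn g g' a b) :
    HasACDerivOn (fun x => f x + g x) (fun x => f' x + g' x) a b :=
  ⟨hf.1.fun_add hg.1, by
    filter_upwards [hf.2, hg.2] with x hfx hgx hx using (hfx hx).add (hgx hx)⟩

theorem mul (hf : HasACDerivOn f f' a b) (hg : HasACDerivOn g g' a b) :
    HasACDerivOn (fun x => f x * g x) (fun x => f' x * g x + f x * g' x) a b :=
  ⟨hf.1.fun_mul hg.1, by
    filter_upwards [hf.2, hg.2] with x hfx hgx hx using (hfx hx).mul (hgx hx)⟩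

theorem const_mul (hf : HasACDerivOn f f' a b) (k : ℝ) :
    HasACDerivOn (fun x => k * f x) (fun x => k * f' x) a b :=
  ⟨hf.1.const_mul k, by filter_upwards [hf.2] with x hfx hx using (hfx hx).const_mul k⟩

theorem contDiff_comp (hf : HasACDerivOn f f' a b) (hφ : ContDiff ℝ 1 φ)
    (hφ' : ∀ x, HasDerivAt φ (φ' x) x) :
    HasACDerivOn (fun x => φ (f x)) (fun x => φ' (f x) * f' x) a b := by
  obtain ⟨C, hC⟩ := hf.1.exists_bound
  obtain ⟨K, hK⟩ := hφ.contDiffOn.exists_lipschitzOnWith one_ne_zero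
    (convex_Icc (-C) C) isCompact_Icc
  refine ⟨absolutelyContinuousOnInterval_comp_of_lipschitzOnWith hK hf.1 fun x hx =>
    abs_le.1 (hC x hx), ?_⟩
  filter_upwards [hf.2] with x hfx hx using (hφ' (f x)).comp x (hfx hx)

theorem exp (hf : HasACDerivOn f f' a b) :
    HasACDerivOn (fun x => Real.exp (f x)) (fun x => Real.exp (f x) * f' x) a b :=
  hf.contDiff_comp Real.contDiff_exp Real.hasDerivAt_exp

theorem of_contDiffOn (hf : ContDiffOn ℝ 1 f (uIcc a b))
    (h : ∀ x ∈ uIcc a b, HasDerivAt f (f' x) x) : HasACDerivOn f f' a b :=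
  ⟨hf.absolutelyContinuousOnInterval, .of_forall h⟩

theorem integral_eq (hf : HasACDerivOn f f' a b) : ∫ s in a..b, f' s = f b - f a := by
  rw [← hf.1.integral_deriv_eq_sub]
  refine intervalIntegral.integral_congr_ae ?_
  filter_upwards [hf.2] with x hx hxab using (hx (uIoc_subset_uIcc hxab)).deriv.symm

theorem of_integral (hint : IntervalIntegrable f' volume a b)
    (h : ∀ t ∈ uIcc a b, f t = f a + ∫ s in a..t, f' s) : HasACDerivOn f f' a b := by
  have hconst : AbsolutelyContinuousOnInterval (fun _ => f a) a b :=
    (contDiff_const (n := 1)).contDiffOn.absolutelyContinuousOnInterval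
  have hac := hint.absolutelyContinuousOnInterval_intervalIntegral (c := a) left_mem_uIcc
  refine ⟨absolutelyContinuousOnInterval_congr (hconst.fun_add hac) h, ?_⟩
  filter_upwards [hint.ae_hasDerivAt_integral, compl_mem_ae_iff.2 (measure_singleton (a ⊓ b)),
    compl_mem_ae_iff.2 (measure_singleton (a ⊔ b))] with x hx hxa hxb hxab
  refine ((hx hxab a left_mem_uIcc).const_add (f a)).congr_of_eventuallyEq ?_
  filter_upwards [Icc_mem_nhds (hxab.1.lt_of_ne' hxa) (hxab.2.lt_of_ne hxb)] with y hy using h y hy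

theorem integral (hf : IntervalIntegrable f volume a b) :
    HasACDerivOn (fun t => ∫ s in a..t, f s) f a b :=
  of_integral hf fun t _ => by simp

end HasACDerivOn

/-! ### A maximum principle for transport inequalities -/

theorem smul_sub_mem_posTangentConeAt {E : Type*} [NormedAddCommGroup E] [NormedSpace ℝ E]
    {K : Set E} {x y : E} (hK : StarConvex ℝ x K) (hy : y ∈ K) {a : ℝ} (ha : 0 ≤ a) :
    a • (y - x) ∈ posTangentConeAt K x := by
  refine mem_posTangentConeAt_of_frequently_mem (Eventually.frequently ?_)
  have hsmall : ∀ᶠ t in 𝓝[>] (0 : ℝ), t * a < 1 :=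
    nhdsWithin_le_nhds ((continuous_mul_const a).tendsto' 0 0 (zero_mul a)
      |>.eventually_lt_const one_pos)
  filter_upwards [hsmall, self_mem_nhdsWithin] with t hta ht
  rw [smul_smul]
  exact hK.add_smul_sub_mem hy (mul_nonneg (le_of_lt ht) ha) hta.le

theorem mul_le_deriv_of_isMaxOn_exp_mul {v : ℝ → ℝ} {v' k T t : ℝ} (ht0 : 0 < t) (htT : t ≤ T)
    (hv : HasDerivWithinAt v v' (Icc 0 T) t)
    (hmax : IsMaxOn (fun s => Real.exp (-k * s) * v s) (Icc 0 T) t) : k * v t ≤ v' := by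
  have hexp : HasDerivAt (fun s => Real.exp (-k * s)) (Real.exp (-k * t) * (-k)) t := by
    simpa using ((hasDerivAt_id t).const_mul (-k)).exp
  have hcone : (0 : ℝ) - t ∈ posTangentConeAt (Icc 0 T) t :=
    sub_mem_posTangentConeAt_of_segment_subset
      ((convex_Icc 0 T).segment_subset ⟨ht0.le, htT⟩ ⟨le_rfl, ht0.le.trans htT⟩)
  have hle := hmax.localize.hasFDerivWithinAt_nonpos
    (hexp.hasDerivWithinAt.mul hv).hasFDerivWithinAt hcone
  have : 0 ≤ t * (Real.exp (-k * t) * (v' - k * v t)) := by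
    simp only [ContinuousLinearMap.toSpanSingleton_apply, smul_eq_mul] at hle
    linarith
  have := nonneg_of_mul_nonneg_right (nonneg_of_mul_nonneg_right this ht0) (Real.exp_pos _)
  linarith

theorem exists_isMaxOn_exp_mul_of_pos {X : Type*} [TopologicalSpace X] {K : Set X}
    (hK : IsCompact K) {T : ℝ} {V : ℝ → X → ℝ}
    (hV : ContinuousOn (Function.uncurry V) (Icc 0 T ×ˢ K)) (h0 : ∀ x ∈ K, V 0 x ≤ 0)
    (hpos : ∃ t ∈ Icc 0 T, ∃ x ∈ K, 0 < V t x) (k : ℝ) :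
    ∃ t ∈ Ioc 0 T, ∃ x ∈ K, 0 < V t x ∧ IsMaxOn (V t) K x ∧
      IsMaxOn (fun s => Real.exp (-k * s) * V s x) (Icc 0 T) t := by
  obtain ⟨t₁, ht₁, x₁, hx₁, hpos₁⟩ := hpos
  have hW : ContinuousOn (fun z : ℝ × X => Real.exp (-k * z.1) * V z.1 z.2) (Icc 0 T ×ˢ K) :=
    ContinuousOn.mul (by fun_prop) hV
  obtain ⟨⟨t, x⟩, ⟨ht, hx⟩, hmax⟩ :=
    (isCompact_Icc.prod hK).exists_isMaxOn ⟨(t₁, x₁), ht₁, hx₁⟩ hW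
  dsimp only at ht hx
  have hle : ∀ s ∈ Icc 0 T, ∀ y ∈ K,
      Real.exp (-k * s) * V s y ≤ Real.exp (-k * t) * V t x := fun s hs y hy =>
    hmax (show (s, y) ∈ Icc 0 T ×ˢ K from ⟨hs, hy⟩)
  have hVpos : 0 < V t x :=
    pos_of_mul_pos_right ((mul_pos (Real.exp_pos _) hpos₁).trans_le (hle t₁ ht₁ x₁ hx₁))
      (Real.exp_pos _).le
  have ht0 : t ≠ 0 := by
    rintro rfl
    exact (h0 x hx).not_gt hVpos
  exact ⟨t, ⟨ht.1.lt_of_ne' ht0, ht.2⟩, x, hx, hVpos,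
    fun y hy => le_of_mul_le_mul_left (hle t ht y hy) (Real.exp_pos _),
    fun s hs => hle s hs x hx⟩

theorem nonpos_of_transport_inequality {E : Type*} [NormedAddCommGroup E] [NormedSpace ℝ E]
    {K : Set E} (hK : IsCompact K) {T B : ℝ} {V Vt : ℝ → E → ℝ} {V' : ℝ → E → E →L[ℝ] ℝ}
    (hV : ContinuousOn (Function.uncurry V) (Icc 0 T ×ˢ K)) (h0 : ∀ x ∈ K, V 0 x ≤ 0)
    (ht : ∀ t ∈ Icc 0 T, ∀ x ∈ K, HasDerivWithinAt (fun s => V s x) (Vt t x) (Icc 0 T) t)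
    (hx : ∀ t ∈ Icc 0 T, ∀ x ∈ K, HasFDerivWithinAt (V t) (V' t x) K x)
    (hineq : ∀ t ∈ Icc 0 T, ∀ x ∈ K, 0 < V t x →
      ∃ w ∈ posTangentConeAt K x, Vt t x ≤ V' t x w + B * V t x) :
    ∀ t ∈ Icc 0 T, ∀ x ∈ K, V t x ≤ 0 := by
  by_contra! hpos
  obtain ⟨t, ht', x, hxK, hVpos, hmaxx, hmaxt⟩ :=
    exists_isMaxOn_exp_mul_of_pos hK hV h0 hpos (B + 1)
  have htT : t ∈ Icc 0 T := Ioc_subset_Icc_self ht'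
  obtain ⟨w, hw, hle⟩ := hineq t htT x hxK hVpos
  have htime := mul_le_deriv_of_isMaxOn_exp_mul ht'.1 ht'.2 (ht t htT x hxK) hmaxt
  have hspace := hmaxx.localize.hasFDerivWithinAt_nonpos (hx t htT x hxK) hw
  linarith

/-! ### Uniqueness of fluid MGFs -/

theorem exists_nonneg_exp_neg_sub_one_eq (α : ℝ) :
    ∃ a, 0 ≤ a ∧ Real.exp (-α) - 1 = a * (0 - α) := by
  refine ⟨(1 - Real.exp (-α)) / α, ?_, ?_⟩
  · rcases le_total 0 α with h | h
    · exact div_nonneg (sub_nonneg.2 (Real.exp_le_one_iff.2 (neg_nonpos.2 h))) h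
    · exact div_nonneg_of_nonpos (sub_nonpos.2 (Real.one_le_exp (neg_nonneg.2 h))) h
  · rcases eq_or_ne α 0 with rfl | h
    · simp
    · field_simp
      ring

theorem mul_exp_neg_sub_one_mem_posTangentConeAt {K : Set ℝ} {α a : ℝ} (hK : StarConvex ℝ α K)
    (h0 : 0 ∈ K) (ha : 0 ≤ a) : a * (Real.exp (-α) - 1) ∈ posTangentConeAt K α := by
  obtain ⟨b, hb, h⟩ := exists_nonneg_exp_neg_sub_one_eq α
  rw [h, ← mul_assoc]
  exact smul_sub_mem_posTangentConeAt hK h0 (mul_nonneg ha hb)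

theorem min_sub_min_mem_segment (x₁ y₁ x₂ y₂ : ℝ) :
    min x₁ y₁ - min x₂ y₂ ∈ segment ℝ (x₁ - x₂) (y₁ - y₂) := by
  rw [segment_eq_uIcc, mem_uIcc]
  grind

/-- The rate of departures `μ (d ∧ c m) + θ (d - d ∧ c m)` of the fluid queue, where `m` stands for
the moment generating function and `d` for its derivative: the factor of `e^{-α} - 1` in the fluid
equation. -/
def departureRate (c μ θ m d : ℝ) : ℝ := θ * d - (θ - μ) * min d (c * m)

theorem exists_departureRate_sub_eq {c μ θ : ℝ} (hμ : 0 ≤ μ) (hθ : 0 ≤ θ) (m₁ d₁ m₂ d₂ : ℝ) :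
    ∃ a b, 0 ≤ a ∧ a ≤ θ + μ ∧ |b| ≤ (θ + μ) * |c| ∧
      departureRate c μ θ m₁ d₁ - departureRate c μ θ m₂ d₂ = a * (d₁ - d₂) + b * (m₁ - m₂) := by
  obtain ⟨κ', κ, hκ', hκ, hsum, h⟩ := min_sub_min_mem_segment d₁ (c * m₁) d₂ (c * m₂)
  obtain rfl : κ' = 1 - κ := eq_sub_of_add_eq hsum
  have hκ1 : κ ≤ 1 := sub_nonneg.1 hκ'
  refine ⟨θ * κ + μ * (1 - κ), -((θ - μ) * κ) * c, by positivity, by nlinarith, ?_, ?_⟩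
  · rw [abs_mul, abs_neg]
    gcongr
    exact abs_le.2 ⟨by nlinarith, by nlinarith⟩
  · simp only [smul_eq_mul] at h
    unfold departureRate
    linear_combination -(θ - μ) * (-h)

theorem exists_gauged_departureRate_sub_le {c μ θ E Λ α B m₁ m₂ : ℝ} (hμ : 0 ≤ μ) (hθ : 0 ≤ θ)
    (hm : E * m₂ < E * m₁) (hB : (θ + μ) * |(1 - Real.exp α) * Λ| +
      (θ + μ) * |c| * |Real.exp (-α) - 1| ≤ B) (d₁ d₂ : ℝ) :
    ∃ a, 0 ≤ a ∧
      E * ((Real.exp (-α) - 1) * departureRate c μ θ m₁ d₁) -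
          E * ((Real.exp (-α) - 1) * departureRate c μ θ m₂ d₂) ≤
        a * (Real.exp (-α) - 1) * (E * (-Real.exp α * Λ) * m₁ + E * d₁ -
          (E * (-Real.exp α * Λ) * m₂ + E * d₂)) + B * (E * m₁ - E * m₂) := by
  obtain ⟨a, b, ha, ha', hb, hrate⟩ := exists_departureRate_sub_eq (c := c) hμ hθ m₁ d₁ m₂ d₂
  refine ⟨a, ha, ?_⟩
  have hzero : a * ((1 - Real.exp α) * Λ) + b * (Real.exp (-α) - 1) ≤ B := by
    refine (le_abs_self _).trans ((abs_add_le _ _).trans (le_trans ?_ hB))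
    rw [abs_mul a, abs_mul b, abs_of_nonneg ha]
    gcongr
  have hexp : Real.exp (-α) * Real.exp α = 1 := by simp [← Real.exp_add]
  calc _ = a * (Real.exp (-α) - 1) * (E * (-Real.exp α * Λ) * m₁ + E * d₁ -
            (E * (-Real.exp α * Λ) * m₂ + E * d₂)) +
          (a * ((1 - Real.exp α) * Λ) + b * (Real.exp (-α) - 1)) * (E * m₁ - E * m₂) := by
        linear_combination E * (Real.exp (-α) - 1) * hrate + a * Λ * (E * m₁ - E * m₂) * hexp
    _ ≤ _ := by gcongr

/-- The reciprocal of the moment generating function of the number of arrivals up to time `t`: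
multiplying a solution by it removes the arrival term from the fluid equation, so that the equation
becomes classical in time even where `lam` is only integrable. -/
noncomputable def arrivalGauge (lam : ℝ → ℝ) (t α : ℝ) : ℝ :=
  Real.exp (-(Real.exp α - 1) * ∫ s in (0 : ℝ)..t, lam s)

section ArrivalGauge

variable {lam : ℝ → ℝ} {T : ℝ}

theorem arrivalGauge_pos (t α : ℝ) : 0 < arrivalGauge lam t α := Real.exp_pos _

theorem hasDerivAt_arrivalGauge (t α : ℝ) : HasDerivAt (arrivalGauge lam t)
    (arrivalGauge lam t α * (-Real.exp α * ∫ s in (0 : ℝ)..t, lam s)) α :=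
  (((Real.hasDerivAt_exp α).sub_const 1).neg.mul_const _).exp

theorem continuousOn_integral_Icc (hT : 0 ≤ T) (hlam : IntervalIntegrable lam volume 0 T) :
    ContinuousOn (fun t => ∫ s in (0 : ℝ)..t, lam s) (Icc 0 T) :=
  uIcc_of_le hT ▸ intervalIntegral.continuousOn_primitive_interval' hlam left_mem_uIcc

theorem continuousOn_arrivalGauge (hT : 0 ≤ T) (hlam : IntervalIntegrable lam volume 0 T)
    (K : Set ℝ) : ContinuousOn (Function.uncurry (arrivalGauge lam)) (Icc 0 T ×ˢ K) := by
  have hΛ : ContinuousOn (fun z : ℝ × ℝ => ∫ s in (0 : ℝ)..z.1, lam s) (Icc 0 T ×ˢ K) :=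
    (continuousOn_integral_Icc hT hlam).comp continuousOn_fst fun z hz => hz.1
  unfold arrivalGauge Function.uncurry
  fun_prop

theorem arrivalGauge_mul_eq_of_integral_eq {w g : ℝ → ℝ} {w₀ α t : ℝ} (ht : 0 ≤ t)
    (hlam : IntervalIntegrable lam volume 0 t) (hw : ContinuousOn w (Icc 0 t))
    (hg : ContinuousOn g (Icc 0 t)) (h : ∀ r ∈ Icc 0 t,
      w r = w₀ + ∫ s in (0 : ℝ)..r, (lam s * (Real.exp α - 1) * w s + g s)) :
    arrivalGauge lam t α * w t = w₀ + ∫ s in (0 : ℝ)..t, arrivalGauge lam s α * g s := by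
  rw [← uIcc_of_le ht] at hw hg h
  have hw₀ : w 0 = w₀ := by simpa using h 0 left_mem_uIcc
  have hW : HasACDerivOn w (fun s => lam s * (Real.exp α - 1) * w s + g s) 0 t :=
    .of_integral (((hlam.mul_const _).mul_continuousOn hw).add hg.intervalIntegrable)
      (hw₀ ▸ h)
  have hgauge := ((HasACDerivOn.integral hlam).const_mul (-(Real.exp α - 1))).exp
  have hprod := (hgauge.mul hW).integral_eq
  simp only [intervalIntegral.integral_same, mul_zero, Real.exp_zero, one_mul, hw₀] at hprod
  rw [arrivalGauge, ← sub_eq_iff_eq_add', ← hprod]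
  refine intervalIntegral.integral_congr fun s _ => ?_
  simp only [arrivalGauge]
  ring

theorem hasDerivWithinAt_arrivalGauge_mul {w g : ℝ → ℝ} {w₀ α t : ℝ} (ht : t ∈ Icc 0 T)
    (hlam : IntervalIntegrable lam volume 0 T) (hw : ContinuousOn w (Icc 0 T))
    (hg : ContinuousOn g (Icc 0 T)) (h : ∀ r ∈ Icc 0 T,
      w r = w₀ + ∫ s in (0 : ℝ)..r, (lam s * (Real.exp α - 1) * w s + g s)) :
    HasDerivWithinAt (fun s => arrivalGauge lam s α * w s) (arrivalGauge lam t α * g t)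
      (Icc 0 T) t := by
  have hT : 0 ≤ T := ht.1.trans ht.2
  have hgauge : ContinuousOn (fun s => arrivalGauge lam s α * g s) (Icc 0 T) :=
    ((continuousOn_arrivalGauge hT hlam {α}).comp (f := fun s => (s, α)) (by fun_prop)
      fun s hs => ⟨hs, rfl⟩).mul hg
  have heq : ∀ r ∈ Icc 0 T, arrivalGauge lam r α * w r =
      w₀ + ∫ s in (0 : ℝ)..r, arrivalGauge lam s α * g s := fun r hr => by
    have hsub : Icc 0 r ⊆ Icc 0 T := Icc_subset_Icc_right hr.2
    refine arrivalGauge_mul_eq_of_integral_eq hr.1 (hlam.mono_set ?_) (hw.mono hsub)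
      (hg.mono hsub) fun s hs => h s (hsub hs)
    rwa [uIcc_of_le hr.1, uIcc_of_le hT]
  have : Fact (t ∈ Icc 0 T) := ⟨ht⟩
  have hint : IntervalIntegrable (fun s => arrivalGauge lam s α * g s) volume 0 t :=
    (hgauge.mono (uIcc_of_le ht.1 ▸ Icc_subset_Icc_right ht.2)).intervalIntegrable
  exact ((intervalIntegral.integral_hasDerivWithinAt_right hint
    (hgauge.stronglyMeasurableAtFilter_nhdsWithin measurableSet_Icc t)
    (hgauge t ht)).const_add w₀).congr heq (heq t ht)

end ArrivalGauge

namespace IsFluidMGF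

variable {lam : ℝ → ℝ} {c μ θ q₀ T : ℝ} {I J K : Set ℝ} {M M₁ M₂ : ℝ → ℝ → ℝ}

theorem mono (h : IsFluidMGF lam c μ θ q₀ I M) (hJ : J ⊆ I) : IsFluidMGF lam c μ θ q₀ J M := by
  obtain ⟨D, hM, hD, hderiv, heq⟩ := h
  exact ⟨D, hM.mono (prod_mono_right hJ), hD.mono (prod_mono_right hJ),
    fun t ht α hα => (hderiv t ht α (hJ hα)).mono hJ, fun t ht α hα => heq t ht α (hJ hα)⟩

theorem exists_deriv (h : IsFluidMGF lam c μ θ q₀ I M) (hlam : IntervalIntegrable lam volume 0 T) :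
    ∃ D : ℝ → ℝ → ℝ, ∀ t ∈ Icc 0 T, ∀ α ∈ I,
      HasDerivWithinAt (M t) (D t α) I α ∧
      HasDerivWithinAt (fun s => arrivalGauge lam s α * M s α) (arrivalGauge lam t α *
        ((Real.exp (-α) - 1) * departureRate c μ θ (M t α) (D t α))) (Icc 0 T) t := by
  obtain ⟨D, hM, hD, hderiv, heq⟩ := h
  refine ⟨D, fun t ht α hα => ⟨hderiv t ht.1 α hα, ?_⟩⟩
  have hslice : ∀ {F : ℝ → ℝ → ℝ}, ContinuousOn (Function.uncurry F) (Ici 0 ×ˢ I) →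
      ContinuousOn (fun s => F s α) (Icc 0 T) := fun hF =>
    hF.comp (f := fun s => (s, α)) (by fun_prop) fun s hs => ⟨hs.1, hα⟩
  have hMα := hslice hM
  have hDα := hslice hD
  refine hasDerivWithinAt_arrivalGauge_mul (w₀ := Real.exp (α * q₀))
    (g := fun s => (Real.exp (-α) - 1) * departureRate c μ θ (M s α) (D s α)) ht hlam hMα
    (by unfold departureRate; fun_prop) fun r hr => ?_
  rw [heq r hr.1 α hα]
  congr 1
  refine intervalIntegral.integral_congr fun s _ => ?_
  simp only [departureRate]
  ring

theorem apply_zero (h : IsFluidMGF lam c μ θ q₀ I M) {α : ℝ} (hα : α ∈ I) :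
    M 0 α = Real.exp (α * q₀) := by
  obtain ⟨D, -, -, -, heq⟩ := h
  simpa using heq 0 le_rfl α hα

theorem continuousOn (h : IsFluidMGF lam c μ θ q₀ I M) :
    ContinuousOn (Function.uncurry M) (Ici 0 ×ˢ I) :=
  let ⟨_, hM, _⟩ := h
  hM

theorem le_of_isCompact_of_convex (hK : IsCompact K) (hKc : Convex ℝ K) (hK0 : 0 ∈ K)
    (hμ : 0 ≤ μ) (hθ : 0 ≤ θ) (hT : 0 ≤ T) (hlam : IntervalIntegrable lam volume 0 T)
    (h₁ : IsFluidMGF lam c μ θ q₀ K M₁) (h₂ : IsFluidMGF lam c μ θ q₀ K M₂) {α : ℝ}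
    (hα : α ∈ K) : M₁ T α ≤ M₂ T α := by
  obtain ⟨D₁, hD₁⟩ := h₁.exists_deriv hlam
  obtain ⟨D₂, hD₂⟩ := h₂.exists_deriv hlam
  have hsub : Icc 0 T ×ˢ K ⊆ Ici 0 ×ˢ K := prod_mono_left Icc_subset_Ici_self
  have hΛ : ContinuousOn (fun z : ℝ × ℝ => ∫ s in (0 : ℝ)..z.1, lam s) (Icc 0 T ×ˢ K) :=
    (continuousOn_integral_Icc hT hlam).comp continuousOn_fst fun z hz => hz.1
  obtain ⟨B, hB⟩ := (isCompact_Icc.prod hK).exists_bound_of_continuousOn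
    (f := fun z : ℝ × ℝ => (θ + μ) * |(1 - Real.exp z.2) * ∫ s in (0 : ℝ)..z.1, lam s| +
      (θ + μ) * |c| * |Real.exp (-z.2) - 1|) (by fun_prop)
  have hle := nonpos_of_transport_inequality hK (B := B)
    (V := fun t α => arrivalGauge lam t α * M₁ t α - arrivalGauge lam t α * M₂ t α)
    (((continuousOn_arrivalGauge hT hlam K).mul (h₁.continuousOn.mono hsub)).sub
      ((continuousOn_arrivalGauge hT hlam K).mul (h₂.continuousOn.mono hsub)))
    (fun β hβ => by simp only [h₁.apply_zero hβ, h₂.apply_zero hβ, sub_self, le_refl])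
    (fun t ht β hβ => (hD₁ t ht β hβ).2.sub (hD₂ t ht β hβ).2)
    (fun t ht β hβ =>
      (((hasDerivAt_arrivalGauge t β).hasDerivWithinAt.mul (hD₁ t ht β hβ).1).sub
        ((hasDerivAt_arrivalGauge t β).hasDerivWithinAt.mul (hD₂ t ht β hβ).1)).hasFDerivWithinAt)
    (fun t ht β hβ hpos => ?_) T ⟨hT, le_rfl⟩ α hα
  · exact le_of_mul_le_mul_left (sub_nonpos.1 hle) (arrivalGauge_pos T α)
  · obtain ⟨a, ha, hrate⟩ := exists_gauged_departureRate_sub_le (c := c) hμ hθ (sub_pos.1 hpos)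
      ((le_abs_self _).trans (hB (t, β) ⟨ht, hβ⟩)) (D₁ t β) (D₂ t β)
    exact ⟨a * (Real.exp (-β) - 1), mul_exp_neg_sub_one_mem_posTangentConeAt
      (hKc.starConvex hβ) hK0 ha, by simpa using hrate⟩

theorem eq_of_ordConnected (hμ : 0 ≤ μ) (hθ : 0 ≤ θ)
    (hlam : IntervalIntegrable lam volume 0 T)
    (h₁ : IsFluidMGF lam c μ θ q₀ I M₁) (h₂ : IsFluidMGF lam c μ θ q₀ J M₂)
    (hI : I.OrdConnected) (hJ : J.OrdConnected) (hI0 : 0 ∈ I) (hJ0 : 0 ∈ J) (hT : 0 ≤ T) :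
    EqOn (M₁ T) (M₂ T) (I ∩ J) := by
  intro α hα
  have h₁' := h₁.mono (hI.uIcc_subset hI0 hα.1)
  have h₂' := h₂.mono (hJ.uIcc_subset hJ0 hα.2)
  exact le_antisymm
    (le_of_isCompact_of_convex isCompact_uIcc (convex_uIcc 0 α) left_mem_uIcc hμ hθ hT hlam h₁' h₂'
      right_mem_uIcc)
    (le_of_isCompact_of_convex isCompact_uIcc (convex_uIcc 0 α) left_mem_uIcc hμ hθ hT hlam h₂' h₁'
      right_mem_uIcc)

end IsFluidMGF

theorem IsMMInfMGF.isFluidMGF {lam : ℝ → ℝ} {θ x₀ : ℝ} {N : ℝ → ℝ → ℝ}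
    (h : IsMMInfMGF lam θ x₀ N) (c : ℝ) : IsFluidMGF lam c θ θ x₀ univ N := by
  obtain ⟨D, hN, hD, hderiv, heq⟩ := h
  refine ⟨D, hN, hD, fun t ht α _ => (hderiv t ht α).hasDerivWithinAt, fun t ht α _ => ?_⟩
  simpa using heq t ht α

theorem IsMMInfMGF.unique {lam : ℝ → ℝ} {θ x₀ T : ℝ} {N₁ N₂ : ℝ → ℝ → ℝ} (hθ : 0 ≤ θ)
    (hlam : IntervalIntegrable lam volume 0 T)
    (h₁ : IsMMInfMGF lam θ x₀ N₁) (h₂ : IsMMInfMGF lam θ x₀ N₂) (hT : 0 ≤ T) : N₁ T = N₂ T :=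
  (eqOn_univ _ _).1 <| univ_inter univ ▸ (h₁.isFluidMGF 0).eq_of_ordConnected hθ hθ hlam
    (h₂.isFluidMGF 0) ordConnected_univ ordConnected_univ trivial trivial hT

/-! ### The MGF of the `M/M/∞` queue -/

/-- The mean at time `t` of the `M/M/∞` queue that starts empty. -/
noncomputable def mmInfMean (lam : ℝ → ℝ) (θ t : ℝ) : ℝ :=
  Real.exp (-θ * t) * ∫ s in (0 : ℝ)..t, Real.exp (θ * s) * lam s

/-- The moment generating function at `α`, at time `t`, of the indicator that a customer present at
time `0` is still present. -/
noncomputable def survivalMGF (θ t α : ℝ) : ℝ := 1 + (Real.exp α - 1) * Real.exp (-θ * t)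

/-- The moment generating function of the `M/M/∞` queue with real initial value `x₀`: the arrivals
contribute a Poisson variable, the initial customers survive independently. -/
noncomputable def mmInfMGF (lam : ℝ → ℝ) (θ x₀ t α : ℝ) : ℝ :=
  Real.exp ((Real.exp α - 1) * mmInfMean lam θ t + x₀ * Real.log (survivalMGF θ t α))

/-- The derivative in `α` of the logarithm of `mmInfMGF`. -/
noncomputable def mmInfLogDeriv (lam : ℝ → ℝ) (θ x₀ t α : ℝ) : ℝ :=
  Real.exp α * (mmInfMean lam θ t + x₀ * (Real.exp (-θ * t) / survivalMGF θ t α))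

section ExplicitMGF

variable {lam : ℝ → ℝ} {θ x₀ t α : ℝ}

theorem exp_neg_mul_le_one (hθ : 0 ≤ θ) (ht : 0 ≤ t) : Real.exp (-θ * t) ≤ 1 :=
  Real.exp_le_one_iff.2 (mul_nonpos_of_nonpos_of_nonneg (neg_nonpos.2 hθ) ht)

theorem hasDerivAt_exp_mul (k x : ℝ) :
    HasDerivAt (fun x => Real.exp (k * x)) (Real.exp (k * x) * k) x := by
  simpa using ((hasDerivAt_id x).const_mul k).exp

theorem survivalMGF_pos (hθ : 0 ≤ θ) (ht : 0 ≤ t) : 0 < survivalMGF θ t α := by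
  have hsplit : survivalMGF θ t α =
      (1 - Real.exp (-θ * t)) + Real.exp α * Real.exp (-θ * t) := by
    unfold survivalMGF
    ring
  rw [hsplit]
  exact add_pos_of_nonneg_of_pos (sub_nonneg.2 (exp_neg_mul_le_one hθ ht)) (by positivity)

theorem hasDerivAt_survivalMGF :
    HasDerivAt (survivalMGF θ t) (Real.exp α * Real.exp (-θ * t)) α :=
  (((Real.hasDerivAt_exp α).sub_const 1).mul_const _).const_add 1

theorem hasACDerivOn_log_survivalMGF (hθ : 0 ≤ θ) (ht : 0 ≤ t) :
    HasACDerivOn (fun s => Real.log (survivalMGF θ s α))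
      (fun s => -θ * ((Real.exp α - 1) * (Real.exp (-θ * s) / survivalMGF θ s α))) 0 t := by
  have hpos : ∀ s ∈ uIcc 0 t, survivalMGF θ s α ≠ 0 := fun s hs =>
    (survivalMGF_pos hθ (uIcc_of_le ht ▸ hs).1).ne'
  refine .of_contDiffOn (ContDiffOn.log (by unfold survivalMGF; fun_prop) hpos) fun s hs => ?_
  exact ((((hasDerivAt_exp_mul (-θ) s).const_mul (Real.exp α - 1)).const_add 1).log
    (hpos s hs)).congr_deriv (by unfold survivalMGF; ring)

theorem hasACDerivOn_mmInfMean (hlam : IntervalIntegrable lam volume 0 t) :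
    HasACDerivOn (mmInfMean lam θ) (fun s => lam s - θ * mmInfMean lam θ s) 0 t := by
  have hexp : HasACDerivOn (fun s => Real.exp (-θ * s)) (fun s => Real.exp (-θ * s) * -θ) 0 t :=
    .of_contDiffOn (by fun_prop) fun s _ => hasDerivAt_exp_mul (-θ) s
  refine (hexp.mul (.integral (hlam.continuousOn_mul (by fun_prop)))).congr_deriv fun s _ => ?_
  have hcancel : Real.exp (-θ * s) * Real.exp (θ * s) = 1 := by simp [← Real.exp_add]
  unfold mmInfMean
  linear_combination lam s * hcancel

theorem continuousOn_mmInfMean (hlam : ∀ T, 0 ≤ T → IntervalIntegrable lam volume 0 T) :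
    ContinuousOn (mmInfMean lam θ) (Ici 0) := by
  intro t ht
  have hT : (0 : ℝ) ≤ t + 1 := add_nonneg ht zero_le_one
  have hcont := (hasACDerivOn_mmInfMean (θ := θ) (hlam _ hT)).1.continuousOn
  rw [uIcc_of_le hT, ← Ici_inter_Iic] at hcont
  exact (hcont t ⟨ht, (lt_add_one t).le⟩).mono_of_mem_nhdsWithin
    (inter_mem_nhdsWithin _ (Iic_mem_nhds (lt_add_one t)))

theorem hasDerivAt_mmInfMGF (hθ : 0 ≤ θ) (ht : 0 ≤ t) :
    HasDerivAt (mmInfMGF lam θ x₀ t) (mmInfMGF lam θ x₀ t α * mmInfLogDeriv lam θ x₀ t α) α := by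
  refine ((((Real.hasDerivAt_exp α).sub_const 1).mul_const _).add
    ((hasDerivAt_survivalMGF.log (survivalMGF_pos hθ ht).ne').const_mul x₀)).exp.congr_deriv ?_
  change mmInfMGF lam θ x₀ t α * _ = _
  unfold mmInfLogDeriv
  ring

theorem continuousOn_mmInfMGF (hθ : 0 ≤ θ)
    (hlam : ∀ T, 0 ≤ T → IntervalIntegrable lam volume 0 T) :
    ContinuousOn (Function.uncurry (mmInfMGF lam θ x₀)) (Ici 0 ×ˢ univ) := by
  have hmean : ContinuousOn (fun z : ℝ × ℝ => mmInfMean lam θ z.1) (Ici 0 ×ˢ univ) :=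
    (continuousOn_mmInfMean hlam).comp continuousOn_fst fun z hz => hz.1
  have hlog : ContinuousOn (fun z : ℝ × ℝ => Real.log (survivalMGF θ z.1 z.2)) (Ici 0 ×ˢ univ) :=
    ContinuousOn.log (by unfold survivalMGF; fun_prop) fun z hz => (survivalMGF_pos hθ hz.1).ne'
  unfold mmInfMGF Function.uncurry
  fun_prop

theorem continuousOn_mmInfLogDeriv (hθ : 0 ≤ θ)
    (hlam : ∀ T, 0 ≤ T → IntervalIntegrable lam volume 0 T) :
    ContinuousOn (Function.uncurry (mmInfLogDeriv lam θ x₀)) (Ici 0 ×ˢ univ) := by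
  have hmean : ContinuousOn (fun z : ℝ × ℝ => mmInfMean lam θ z.1) (Ici 0 ×ˢ univ) :=
    (continuousOn_mmInfMean hlam).comp continuousOn_fst fun z hz => hz.1
  have hdiv : ContinuousOn (fun z : ℝ × ℝ => Real.exp (-θ * z.1) / survivalMGF θ z.1 z.2)
      (Ici 0 ×ˢ univ) :=
    ContinuousOn.div (by fun_prop) (by unfold survivalMGF; fun_prop) fun z hz =>
      (survivalMGF_pos hθ hz.1).ne'
  unfold mmInfLogDeriv Function.uncurry
  fun_prop

theorem exp_neg_sub_one_mul_mmInfLogDeriv : (Real.exp (-α) - 1) * mmInfLogDeriv lam θ x₀ t α =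
    -(Real.exp α - 1) * (mmInfMean lam θ t + x₀ * (Real.exp (-θ * t) / survivalMGF θ t α)) := by
  have hcancel : Real.exp (-α) * Real.exp α = 1 := by simp [← Real.exp_add]
  unfold mmInfLogDeriv
  linear_combination
    (mmInfMean lam θ t + x₀ * (Real.exp (-θ * t) / survivalMGF θ t α)) * hcancel

theorem isMMInfMGF_mmInfMGF (hθ : 0 ≤ θ)
    (hlam : ∀ T, 0 ≤ T → IntervalIntegrable lam volume 0 T) :
    IsMMInfMGF lam θ x₀ (mmInfMGF lam θ x₀) := by
  refine ⟨fun t α => mmInfMGF lam θ x₀ t α * mmInfLogDeriv lam θ x₀ t α,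
    continuousOn_mmInfMGF hθ hlam,
    (continuousOn_mmInfMGF hθ hlam).mul (continuousOn_mmInfLogDeriv hθ hlam),
    fun t ht α => hasDerivAt_mmInfMGF hθ ht, fun t ht α => ?_⟩
  have hzero : mmInfMGF lam θ x₀ 0 α = Real.exp (α * x₀) := by
    simp [mmInfMGF, mmInfMean, survivalMGF, mul_comm]
  have hac : HasACDerivOn (fun t => mmInfMGF lam θ x₀ t α) _ 0 t :=
    (((hasACDerivOn_mmInfMean (θ := θ) (hlam t ht)).const_mul (Real.exp α - 1)).add
      ((hasACDerivOn_log_survivalMGF (α := α) hθ ht).const_mul x₀)).exp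
  rw [← hzero, ← sub_eq_iff_eq_add', ← hac.integral_eq]
  refine intervalIntegral.integral_congr fun s _ => ?_
  change mmInfMGF lam θ x₀ s α * _ = _
  linear_combination -θ * mmInfMGF lam θ x₀ s α *
    exp_neg_sub_one_mul_mmInfLogDeriv (lam := lam) (θ := θ) (x₀ := x₀) (t := s) (α := α)

theorem analyticOnNhd_mmInfMGF (hθ : 0 ≤ θ) (ht : 0 ≤ t) :
    AnalyticOnNhd ℝ (mmInfMGF lam θ x₀ t) univ := by
  intro α _
  have hlog : AnalyticAt ℝ (fun α => Real.log (survivalMGF θ t α)) α :=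
    AnalyticAt.log (by unfold survivalMGF; fun_prop) (survivalMGF_pos hθ ht)
  unfold mmInfMGF
  fun_prop

theorem mul_one_sub_exp_le_mul_mmInfMean {l : ℝ} (hθ : 0 ≤ θ) (ht : 0 ≤ t)
    (hlam : IntervalIntegrable lam volume 0 t) (hl : ∀ᵐ s, 0 ≤ s → l ≤ lam s) :
    l * (1 - Real.exp (-θ * t)) ≤ θ * mmInfMean lam θ t := by
  have hconst : ∫ s in (0 : ℝ)..t, Real.exp (θ * s) * θ = Real.exp (θ * t) - 1 := by
    simpa using (HasACDerivOn.of_contDiffOn (a := 0) (b := t) (by fun_prop)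
      fun s _ => hasDerivAt_exp_mul θ s).integral_eq
  have hle : ∫ s in (0 : ℝ)..t, Real.exp (θ * s) * l ≤
      ∫ s in (0 : ℝ)..t, Real.exp (θ * s) * lam s := by
    refine intervalIntegral.integral_mono_ae_restrict ht
      (Continuous.intervalIntegrable (by fun_prop) _ _) (hlam.continuousOn_mul (by fun_prop)) ?_
    rw [EventuallyLE, ae_restrict_iff' measurableSet_Icc]
    filter_upwards [hl] with s hs hst
    gcongr
    exact hs hst.1
  have hcancel : Real.exp (-θ * t) * Real.exp (θ * t) = 1 := by simp [← Real.exp_add]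
  rw [intervalIntegral.integral_mul_const] at hconst hle
  calc l * (1 - Real.exp (-θ * t))
      = θ * (Real.exp (-θ * t) * ((∫ s in (0 : ℝ)..t, Real.exp (θ * s)) * l)) := by
        linear_combination -l * hcancel - Real.exp (-θ * t) * l * hconst
    _ ≤ θ * mmInfMean lam θ t := by unfold mmInfMean; gcongr

theorem min_one_exp_le_exp_mul (hθ : 0 ≤ θ) (ht : 0 ≤ t) : min 1 (Real.exp α) ≤
    Real.exp α * (1 - Real.exp (-θ * t) + Real.exp (-θ * t) / survivalMGF θ t α) := by
  have hS := survivalMGF_pos (α := α) hθ ht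
  have he0 := Real.exp_pos (-θ * t)
  have he1 := sub_nonneg.2 (exp_neg_mul_le_one hθ ht)
  have hα := Real.exp_pos α
  have hdef : survivalMGF θ t α = 1 + (Real.exp α - 1) * Real.exp (-θ * t) := rfl
  rcases le_total (Real.exp α) 1 with h | h
  · rw [min_eq_right h]
    have hle : Real.exp (-θ * t) ≤ Real.exp (-θ * t) / survivalMGF θ t α :=
      le_div_self he0.le hS (by nlinarith)
    nlinarith
  · rw [min_eq_left h]
    have hrewrite : Real.exp α * (Real.exp (-θ * t) / survivalMGF θ t α) =
        1 - (1 - Real.exp (-θ * t)) / survivalMGF θ t α := by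
      rw [← mul_div_assoc, eq_sub_iff_add_eq, ← add_div, div_eq_one_iff_eq hS.ne']
      linear_combination -hdef
    have hle : (1 - Real.exp (-θ * t)) / survivalMGF θ t α ≤ 1 - Real.exp (-θ * t) :=
      div_le_self he1 (by nlinarith)
    nlinarith

theorem mul_min_one_exp_le_mmInfLogDeriv {b l : ℝ} (hθ : 0 < θ) (ht : 0 ≤ t)
    (hlam : IntervalIntegrable lam volume 0 t) (hl : ∀ᵐ s, 0 ≤ s → l ≤ lam s)
    (hb : 0 ≤ b) (hbl : θ * b ≤ l) (hbx : b ≤ x₀) :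
    b * min 1 (Real.exp α) ≤ mmInfLogDeriv lam θ x₀ t α := by
  have hS := survivalMGF_pos (α := α) hθ.le ht
  have he := sub_nonneg.2 (exp_neg_mul_le_one hθ.le ht)
  have hmean : b * (1 - Real.exp (-θ * t)) ≤ mmInfMean lam θ t := by
    refine le_of_mul_le_mul_left ?_ hθ
    rw [← mul_assoc]
    exact (mul_le_mul_of_nonneg_right hbl he).trans
      (mul_one_sub_exp_le_mul_mmInfMean hθ.le ht hlam hl)
  calc b * min 1 (Real.exp α)
      ≤ b * (Real.exp α * (1 - Real.exp (-θ * t) + Real.exp (-θ * t) / survivalMGF θ t α)) := by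
        gcongr
        exact min_one_exp_le_exp_mul hθ.le ht
    _ = Real.exp α *
          (b * (1 - Real.exp (-θ * t)) + b * (Real.exp (-θ * t) / survivalMGF θ t α)) := by ring
    _ ≤ mmInfLogDeriv lam θ x₀ t α := by unfold mmInfLogDeriv; gcongr

theorem exists_le_mmInfLogDeriv {l κ : ℝ} (hθ : 0 < θ) (hκ : 0 ≤ κ) (hκl : θ * κ < l)
    (hκx : κ < x₀) (hlam : ∀ T, 0 ≤ T → IntervalIntegrable lam volume 0 T)
    (hl : ∀ᵐ s, 0 ≤ s → l ≤ lam s) :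
    ∃ δ, 0 < δ ∧ ∀ t, 0 ≤ t → ∀ α, -δ < α → κ ≤ mmInfLogDeriv lam θ x₀ t α := by
  obtain ⟨b, hκb, hb⟩ := exists_between (lt_min ((lt_div_iff₀' hθ).2 hκl) hκx)
  obtain ⟨hbl, hbx⟩ := lt_min_iff.1 hb
  have hb0 : 0 < b := hκ.trans_lt hκb
  refine ⟨1 - κ / b, sub_pos.2 ((div_lt_one hb0).2 hκb), fun t ht α hα => le_trans ?_
    (mul_min_one_exp_le_mmInfLogDeriv hθ ht (hlam t ht) hl hb0.le ((lt_div_iff₀' hθ).1 hbl).le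
      hbx.le)⟩
  rw [← div_le_iff₀' hb0, le_min_iff]
  exact ⟨((div_lt_one hb0).2 hκb).le, by linarith [Real.add_one_le_exp α]⟩

end ExplicitMGF

theorem IsMMInfMGF.isFluidMGF_exp_mul {lam : ℝ → ℝ} {c μ θ q₀ γ : ℝ} {N : ℝ → ℝ → ℝ} {I : Set ℝ}
    (h : IsMMInfMGF lam θ (q₀ - γ) N) (hγ : θ * γ = c * (θ - μ))
    (hI : ∀ t, 0 ≤ t → ∀ α ∈ I, (c - γ) * N t α ≤ deriv (N t) α) :
    IsFluidMGF lam c μ θ q₀ I (fun t α => Real.exp (α * γ) * N t α) := by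
  obtain ⟨D, hN, hD, hderiv, heq⟩ := h
  have hsub : Ici (0 : ℝ) ×ˢ I ⊆ Ici 0 ×ˢ univ := prod_mono_right (subset_univ _)
  refine ⟨fun t α => Real.exp (α * γ) * (γ * N t α + D t α),
    ContinuousOn.mul (by fun_prop) (hN.mono hsub),
    ContinuousOn.mul (by fun_prop) (((hN.mono hsub).const_mul γ).add (hD.mono hsub)),
    fun t ht α _ => ?_, fun t ht α hα => ?_⟩
  · have hexp : HasDerivAt (fun α : ℝ => Real.exp (α * γ)) (Real.exp (α * γ) * γ) α := by
      simpa using ((hasDerivAt_id α).mul_const γ).exp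
    exact (hexp.mul (hderiv t ht α)).hasDerivWithinAt.congr_deriv (by ring)
  · have hinit : Real.exp (α * q₀) = Real.exp (α * γ) * Real.exp (α * (q₀ - γ)) := by
      rw [← Real.exp_add, ← mul_add, add_sub_cancel]
    simp only
    rw [heq t ht α, hinit, mul_add, ← intervalIntegral.integral_const_mul]
    congr 1
    refine intervalIntegral.integral_congr fun s hs => ?_
    have hs0 : 0 ≤ s := (uIcc_of_le ht ▸ hs).1
    have hle : c * (Real.exp (α * γ) * N s α) ≤ Real.exp (α * γ) * (γ * N s α + D s α) := by
      rw [mul_left_comm]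
      gcongr
      linarith [(hderiv s hs0 α).deriv ▸ hI s hs0 α hα]
    rw [min_eq_right hle]
    linear_combination -(Real.exp (α * γ) * (Real.exp (-α) - 1) * N s α) * hγ

theorem exists_isFluidMGF_exp_mul_mmInfMGF {lam : ℝ → ℝ} {c μ θ q₀ γ l : ℝ} (hc : 0 ≤ c)
    (hμ : 0 ≤ μ) (hθ : 0 < θ) (hlam : ∀ T, 0 ≤ T → IntervalIntegrable lam volume 0 T)
    (hcl : c * μ < l) (hl : ∀ᵐ s, 0 ≤ s → l ≤ lam s) (hq : c < q₀) (hγ : γ = c * (θ - μ) / θ) :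
    ∃ δ, 0 < δ ∧ IsFluidMGF lam c μ θ q₀ (Ioi (-δ))
      (fun t α => Real.exp (α * γ) * mmInfMGF lam θ (q₀ - γ) t α) := by
  have hγ' : θ * γ = c * (θ - μ) := by rw [hγ, mul_div_cancel₀ _ hθ.ne']
  have hκ : θ * (c - γ) = c * μ := by linear_combination -hγ'
  have hκ0 : 0 ≤ c - γ := nonneg_of_mul_nonneg_right (hκ ▸ mul_nonneg hc hμ) hθ
  obtain ⟨δ, hδ, hle⟩ := exists_le_mmInfLogDeriv (x₀ := q₀ - γ) hθ hκ0 (hκ ▸ hcl)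
    (sub_lt_sub_right hq γ) hlam hl
  refine ⟨δ, hδ, (isMMInfMGF_mmInfMGF hθ.le hlam).isFluidMGF_exp_mul hγ' fun t ht α hα => ?_⟩
  rw [(hasDerivAt_mmInfMGF hθ.le ht).deriv, mul_comm]
  gcongr
  exacts [(Real.exp_pos _).le, hle t ht α hα]

/-! ### Laws of the `M/M/∞` queue -/

/-- The probability generating function at `z` of the state at time `T` of the `M/M/∞` queue with
`n` customers at time `s`. As a function of `(s, n)` it solves the backward equations. -/
noncomputable def mmInfBackward (lam : ℝ → ℝ) (θ T z : ℝ) (n : ℕ) (s : ℝ) : ℝ :=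
  (1 + (z - 1) * Real.exp (-θ * (T - s))) ^ n *
    Real.exp ((z - 1) * (mmInfMean lam θ T - Real.exp (-θ * (T - s)) * mmInfMean lam θ s))

section Backward

variable {lam : ℝ → ℝ} {θ T z : ℝ}

theorem mmInfBackward_self (n : ℕ) : mmInfBackward lam θ T z n T = z ^ n := by
  simp [mmInfBackward]

theorem mmInfBackward_zero_right (n : ℕ) : mmInfBackward lam θ T z n 0 =
    (1 + (z - 1) * Real.exp (-θ * T)) ^ n * Real.exp ((z - 1) * mmInfMean lam θ T) := by
  simp [mmInfBackward, mmInfMean]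

theorem hasDerivAt_exp_neg_mul_sub (s : ℝ) : HasDerivAt (fun s => Real.exp (-θ * (T - s)))
    (θ * Real.exp (-θ * (T - s))) s :=
  ((((hasDerivAt_id s).const_sub T).const_mul (-θ)).exp).congr_deriv (by simp [mul_comm])

theorem hasACDerivOn_mmInfBackward (hlam : IntervalIntegrable lam volume 0 T) (n : ℕ) :
    HasACDerivOn (mmInfBackward lam θ T z n) (fun s =>
      -lam s * (mmInfBackward lam θ T z (n + 1) s - mmInfBackward lam θ T z n s) -
        θ * n * (mmInfBackward lam θ T z (n - 1) s - mmInfBackward lam θ T z n s)) 0 T := by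
  have hpow : HasACDerivOn (fun s => (1 + (z - 1) * Real.exp (-θ * (T - s))) ^ n) _ 0 T :=
    .of_contDiffOn (by fun_prop) fun s _ =>
      (((hasDerivAt_exp_neg_mul_sub s).const_mul (z - 1)).const_add 1).fun_pow n
  have hdecay : HasACDerivOn (fun s => Real.exp (-θ * (T - s))) _ 0 T :=
    .of_contDiffOn (by fun_prop) fun s _ => hasDerivAt_exp_neg_mul_sub s
  have hconst : HasACDerivOn (fun _ => mmInfMean lam θ T) _ 0 T :=
    .of_contDiffOn contDiffOn_const fun s _ => hasDerivAt_const s _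
  have hmean := hasACDerivOn_mmInfMean (θ := θ) hlam
  have hexp := ((hconst.add ((hdecay.mul hmean).const_mul (-1))).const_mul (z - 1)).exp
  simp only [neg_one_mul, ← sub_eq_add_neg] at hexp
  refine (hpow.mul hexp).congr_deriv fun s _ => ?_
  unfold mmInfBackward
  rcases n with _ | n
  · simp
    ring
  · simp only [Nat.add_sub_cancel]
    ring

theorem exists_abs_mmInfBackward_le (hθ : 0 ≤ θ) (hT : 0 ≤ T) (hz0 : 0 ≤ z) (hz1 : z < 1)
    (hlam : IntervalIntegrable lam volume 0 T) : ∃ C r, 0 ≤ C ∧ 0 ≤ r ∧ r < 1 ∧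
      ∀ s ∈ Icc 0 T, ∀ n, |mmInfBackward lam θ T z n s| ≤ C * r ^ n := by
  obtain ⟨C, hC⟩ := (hasACDerivOn_mmInfBackward (θ := θ) (z := z) hlam 0).1.exists_bound
  refine ⟨C, 1 + (z - 1) * Real.exp (-θ * T), (norm_nonneg _).trans (hC 0 left_mem_uIcc),
    ?_, ?_, fun s hs n => ?_⟩
  · nlinarith [exp_neg_mul_le_one hθ hT, Real.exp_pos (-θ * T)]
  · nlinarith [Real.exp_pos (-θ * T)]
  · have hbound := hC s (uIcc_of_le hT ▸ hs)
    have hle : Real.exp (-θ * T) ≤ Real.exp (-θ * (T - s)) :=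
      Real.exp_le_exp.2 (by nlinarith [hs.1])
    have hle1 := exp_neg_mul_le_one hθ (sub_nonneg.2 hs.2)
    have hφ0 : 0 ≤ 1 + (z - 1) * Real.exp (-θ * (T - s)) := by
      nlinarith [Real.exp_pos (-θ * (T - s))]
    simp only [mmInfBackward, pow_zero, one_mul, Real.norm_eq_abs] at hbound
    rw [mmInfBackward, abs_mul, abs_of_nonneg (pow_nonneg hφ0 n), mul_comm]
    refine mul_le_mul hbound (pow_le_pow_left₀ hφ0 ?_ n) (pow_nonneg hφ0 n)
      ((abs_nonneg _).trans hbound)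
    nlinarith

end Backward

theorem hasSum_mul_pow_of_eventually {p : ℕ → ℂ} {G : ℂ → ℂ} (hG : Differentiable ℂ G)
    (h : ∀ᶠ x : ℝ in 𝓝[>] 0, HasSum (fun n => p n * (x : ℂ) ^ n) (G x)) (z : ℂ) :
    HasSum (fun n => p n * z ^ n) (G z) := by
  set q := FormalMultilinearSeries.ofScalars ℂ p with hq
  have hradius : 0 < q.radius := by
    obtain ⟨x, hsum, hx⟩ := (h.and self_mem_nhdsWithin).exists
    lift x to NNReal using le_of_lt hx
    have hx0 : 0 < x := by exact_mod_cast hx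
    refine (ENNReal.coe_pos.2 hx0).trans_le (q.le_radius_of_summable ?_)
    simpa [hq, FormalMultilinearSeries.ofScalars_norm] using hsum.summable.norm
  have hqs := q.hasFPowerSeriesOnBall hradius
  have hsum_eq : q.sum =ᶠ[𝓝 0] G := by
    refine (hqs.analyticAt.frequently_eq_iff_eventually_eq (hG.analyticAt 0)).1 ?_
    have htendsto : Tendsto (fun x : ℝ => (x : ℂ)) (𝓝[>] 0) (𝓝[≠] 0) := by
      refine tendsto_nhdsWithin_iff.2 ⟨?_, ?_⟩
      · exact (Complex.continuous_ofReal.tendsto' 0 0 (by simp)).mono_left nhdsWithin_le_nhds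
      · filter_upwards [self_mem_nhdsWithin] with x hx
        exact Complex.ofReal_ne_zero.2 (ne_of_gt hx)
    refine htendsto.frequently (h.mono fun x hx => ?_).frequently
    rw [← hx.tsum_eq, FormalMultilinearSeries.sum]
    exact tsum_congr fun n => by simp [hq, mul_comm]
  have hball := hG.hasFPowerSeriesOnBall 0 (R := 1) one_pos
  rw [hball.hasFPowerSeriesAt.eq_formalMultilinearSeries
    (hqs.hasFPowerSeriesAt.congr hsum_eq)] at hball
  simpa [hq, FormalMultilinearSeries.ofScalars_apply_eq, mul_comm] using
    hball.hasSum (y := z) (by simp)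

theorem abs_mul_sub_mul_le_of_abs_le_geometric {θ ℓ C r a b : ℝ} {m : ℕ} (hθ : 0 ≤ θ) (hC : 0 ≤ C)
    (hr0 : 0 ≤ r) (hr1 : r ≤ 1) (ha : |a| ≤ C * r ^ m) (hb : |b| ≤ C * r ^ (m + 1)) :
    |θ * (m + 1) * a - ℓ * b| ≤ (m * r ^ m + r ^ m) * (C * (θ + |ℓ|)) := by
  calc |θ * (m + 1) * a - ℓ * b| ≤ |θ * (m + 1) * a| + |ℓ * b| := abs_sub _ _
    _ = θ * (m + 1) * |a| + |ℓ| * |b| := by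
        rw [abs_mul, abs_mul ℓ, abs_of_nonneg (by positivity : 0 ≤ θ * (m + 1))]
    _ ≤ θ * (m + 1) * (C * r ^ m) + |ℓ| * (C * r ^ m) := by
        gcongr
        exact hb.trans (by gcongr ?_ * ?_; exact pow_le_pow_of_le_one hr0 hr1 m.le_succ)
    _ ≤ θ * (m + 1) * (C * r ^ m) + (m + 1) * (|ℓ| * (C * r ^ m)) := by
        have hm : (1 : ℝ) ≤ m + 1 := le_add_of_nonneg_left m.cast_nonneg
        exact add_le_add_right (le_mul_of_one_le_left (by positivity) hm) _
    _ = (m * r ^ m + r ^ m) * (C * (θ + |ℓ|)) := by ring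

namespace IsMMInfLaw

variable {lam : ℝ → ℝ} {θ T z : ℝ} {n₀ : ℕ} {P : ℝ → Measure ℕ}

theorem real_le_one (h : IsMMInfLaw lam θ n₀ P) {t : ℝ} (ht : 0 ≤ t) (n : ℕ) :
    (P t).real {n} ≤ 1 :=
  have := h.prob t ht
  measureReal_le_one

theorem hasACDerivOn_real (h : IsMMInfLaw lam θ n₀ P) (hT : 0 ≤ T)
    (hlam : IntervalIntegrable lam volume 0 T) (n : ℕ) :
    HasACDerivOn (fun t => (P t).real {n}) (fun s =>
      lam s * ((if n = 0 then 0 else (P s).real {n - 1}) - (P s).real {n})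
        + θ * (((n : ℝ) + 1) * (P s).real {n + 1} - (n : ℝ) * (P s).real {n})) 0 T := by
  have hcont : ∀ n : ℕ, ContinuousOn (fun s => (P s).real {n}) (uIcc 0 T) := fun n =>
    (h.cont n).mono (uIcc_of_le hT ▸ Icc_subset_Ici_self)
  have hprev : ContinuousOn (fun s => if n = 0 then 0 else (P s).real {n - 1}) (uIcc 0 T) := by
    split_ifs
    exacts [continuousOn_const, hcont (n - 1)]
  have hn := hcont n
  have hsucc := hcont (n + 1)
  exact .of_integral ((hlam.mul_continuousOn (hprev.sub hn)).add
    (ContinuousOn.intervalIntegrable (by fun_prop)))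
    fun t ht => h.forward t (uIcc_of_le hT ▸ ht).1 n

/- Forward and backward equations are dual, so that the derivative telescopes: only the flow of
probability between the states `m` and `m + 1` remains. -/
theorem hasACDerivOn_sum_mul_mmInfBackward (h : IsMMInfLaw lam θ n₀ P) (hT : 0 ≤ T)
    (hlam : IntervalIntegrable lam volume 0 T) (m : ℕ) :
    HasACDerivOn
      (fun s => ∑ n ∈ Finset.range (m + 1), (P s).real {n} * mmInfBackward lam θ T z n s)
      (fun s => θ * (m + 1) * ((P s).real {m + 1} * mmInfBackward lam θ T z m s) -
        lam s * ((P s).real {m} * mmInfBackward lam θ T z (m + 1) s)) 0 T := by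
  have hterm := fun n => (h.hasACDerivOn_real hT hlam n).mul
    (hasACDerivOn_mmInfBackward (θ := θ) (z := z) hlam n)
  induction m with
  | zero =>
    simp only [zero_add, Finset.sum_range_one]
    refine (hterm 0).congr_deriv fun s _ => ?_
    simp only [if_true, Nat.cast_zero, zero_add]
    ring
  | succ m ih =>
    simp only [Finset.sum_range_succ _ (m + 1)]
    refine (ih.add (hterm (m + 1))).congr_deriv fun s _ => ?_
    simp only [m.succ_ne_zero, if_false, Nat.add_sub_cancel]
    push_cast
    ring

theorem tendsto_sum_mul_mmInfBackward_sub (h : IsMMInfLaw lam θ n₀ P) (hθ : 0 ≤ θ) (hT : 0 ≤ T)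
    (hlam : IntervalIntegrable lam volume 0 T) (hz0 : 0 ≤ z) (hz1 : z < 1) :
    Tendsto (fun m => ∑ n ∈ Finset.range m, (P T).real {n} * mmInfBackward lam θ T z n T -
      ∑ n ∈ Finset.range m, (P 0).real {n} * mmInfBackward lam θ T z n 0) atTop (𝓝 0) := by
  obtain ⟨C, r, hC, hr0, hr1, hbound⟩ := exists_abs_mmInfBackward_le hθ hT hz0 hz1 hlam
  rw [← tendsto_add_atTop_iff_nat 1]
  simp only [← (h.hasACDerivOn_sum_mul_mmInfBackward hT hlam _).integral_eq]
  have hflow : ∀ s ∈ Icc 0 T, ∀ k n, |(P s).real {k} * mmInfBackward lam θ T z n s| ≤ C * r ^ n :=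
    fun s hs k n => by
      rw [abs_mul, abs_of_nonneg measureReal_nonneg]
      exact (mul_le_of_le_one_left (abs_nonneg _) (h.real_le_one hs.1 k)).trans (hbound s hs n)
  have hdom : ∀ m : ℕ, ‖∫ s in (0 : ℝ)..T,
      (θ * (m + 1) * ((P s).real {m + 1} * mmInfBackward lam θ T z m s) -
        lam s * ((P s).real {m} * mmInfBackward lam θ T z (m + 1) s))‖ ≤
      (m * r ^ m + r ^ m) * ∫ s in (0 : ℝ)..T, C * (θ + |lam s|) := fun m => by
    rw [← intervalIntegral.integral_const_mul]
    refine intervalIntegral.norm_integral_le_of_norm_le hT (.of_forall fun s hs => ?_)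
      (((intervalIntegrable_const.add hlam.abs).const_mul C).const_mul _)
    have hs' : s ∈ Icc 0 T := Ioc_subset_Icc_self hs
    exact abs_mul_sub_mul_le_of_abs_le_geometric hθ hC hr0 hr1.le (hflow s hs' _ _)
      (hflow s hs' _ _)
  refine squeeze_zero_norm hdom ?_
  have hdecay := (tendsto_self_mul_const_pow_of_lt_one hr0 hr1).add
    (tendsto_pow_atTop_nhds_zero_of_lt_one hr0 hr1)
  simpa using hdecay.mul_const (∫ s in (0 : ℝ)..T, C * (θ + |lam s|))

theorem hasSum_init_mul (h : IsMMInfLaw lam θ n₀ P) (u : ℕ → ℝ) :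
    HasSum (fun n => (P 0).real {n} * u n) (u n₀) := by
  rw [h.init]
  convert hasSum_single (f := fun n => (Measure.dirac n₀).real {n} * u n) n₀ fun n hn => ?_ using 1
  · simp [measureReal_def]
  · simp [measureReal_def, hn.symm]

theorem hasSum_pow_of_lt_one (h : IsMMInfLaw lam θ n₀ P) (hθ : 0 ≤ θ) (hT : 0 ≤ T)
    (hlam : IntervalIntegrable lam volume 0 T) (hz0 : 0 ≤ z) (hz1 : z < 1) :
    HasSum (fun n => (P T).real {n} * z ^ n)
      ((1 + (z - 1) * Real.exp (-θ * T)) ^ n₀ * Real.exp ((z - 1) * mmInfMean lam θ T)) := by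
  rw [← mmInfBackward_zero_right,
    hasSum_iff_tendsto_nat_of_nonneg fun n => mul_nonneg measureReal_nonneg (pow_nonneg hz0 n)]
  simpa [mmInfBackward_self] using (h.tendsto_sum_mul_mmInfBackward_sub hθ hT hlam hz0 hz1).add
    (h.hasSum_init_mul fun n => mmInfBackward lam θ T z n 0).tendsto_sum_nat

theorem hasSum_pow (h : IsMMInfLaw lam θ n₀ P) (hθ : 0 ≤ θ) (hT : 0 ≤ T)
    (hlam : IntervalIntegrable lam volume 0 T) (z : ℝ) :
    HasSum (fun n => (P T).real {n} * z ^ n)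
      ((1 + (z - 1) * Real.exp (-θ * T)) ^ n₀ * Real.exp ((z - 1) * mmInfMean lam θ T)) := by
  have hentire := hasSum_mul_pow_of_eventually (p := fun n => ((P T).real {n} : ℂ))
    (G := fun z => (1 + (z - 1) * (Real.exp (-θ * T) : ℂ)) ^ n₀ *
      Complex.exp ((z - 1) * (mmInfMean lam θ T : ℂ))) (by fun_prop) ?_ z
  · exact_mod_cast hentire
  · filter_upwards [Ioo_mem_nhdsGT (zero_lt_one' ℝ)] with x hx
    exact_mod_cast h.hasSum_pow_of_lt_one hθ hT hlam hx.1.le hx.2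

theorem hasSum_exp (h : IsMMInfLaw lam θ n₀ P) (hθ : 0 ≤ θ) (hT : 0 ≤ T)
    (hlam : IntervalIntegrable lam volume 0 T) (α : ℝ) :
    HasSum (fun k : ℕ => (P T).real {k} * Real.exp (α * k)) (mmInfMGF lam θ n₀ T α) := by
  have hpow : ∀ k : ℕ, Real.exp (α * k) = Real.exp α ^ k := fun k => by
    rw [← Real.exp_nat_mul, mul_comm]
  simp only [hpow]
  convert h.hasSum_pow hθ hT hlam (Real.exp α) using 1
  rw [mmInfMGF, Real.exp_add, mul_comm, Real.exp_nat_mul, Real.exp_log (survivalMGF_pos hθ hT),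
    survivalMGF]

theorem integrable_exp (h : IsMMInfLaw lam θ n₀ P) (hθ : 0 ≤ θ) (hT : 0 ≤ T)
    (hlam : IntervalIntegrable lam volume 0 T) (α : ℝ) :
    Integrable (fun k : ℕ => Real.exp (α * (k : ℝ))) (P T) := by
  have := h.prob T hT
  rw [← Measure.sum_smul_dirac (P T)]
  refine integrable_sum_dirac (fun k => measure_ne_top _ _) ?_
  simpa [measureReal_def] using (h.hasSum_exp hθ hT hlam α).summable

theorem mgf_natCast (h : IsMMInfLaw lam θ n₀ P) (hθ : 0 ≤ θ) (hT : 0 ≤ T)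
    (hlam : IntervalIntegrable lam volume 0 T) :
    mgf (fun k : ℕ => (k : ℝ)) (P T) = mmInfMGF lam θ n₀ T := by
  have := h.prob T hT
  funext α
  rw [mgf, integral_countable (h.integrable_exp hθ hT hlam α)]
  exact (h.hasSum_exp hθ hT hlam α).tsum_eq

end IsMMInfLaw

/-! ### Analytic continuation -/

theorem eq_of_analyticOnNhd_of_eventuallyEq_nhdsWithin {E : Type*} [NormedAddCommGroup E]
    [NormedSpace ℝ E] {f g : ℝ → E} (hf : AnalyticOnNhd ℝ f univ) (hg : AnalyticOnNhd ℝ g univ)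
    {I : Set ℝ} (hI : IsPreconnected I) (hI' : I.Nontrivial) {x : ℝ} (hx : x ∈ I)
    (h : f =ᶠ[𝓝[I] x] g) : f = g := by
  have hfreq : ∃ᶠ y in 𝓝[≠] x, y ∈ I :=
    accPt_iff_frequently_nhdsNE.1 (hI.preperfect_of_nontrivial hI' x hx)
  have hev : ∀ᶠ y in 𝓝[≠] x, y ∈ I → f y = g y :=
    nhdsWithin_le_nhds (eventually_nhdsWithin_iff.1 h)
  exact hf.eq_of_frequently_eq hg ((hfreq.and_eventually hev).mono fun y hy => hy.2 hy.1)

theorem analyticOnNhd_mgf_id {ν : Measure ℝ}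
    (h : ∀ α, Integrable (fun x : ℝ => Real.exp (α * x)) ν) : AnalyticOnNhd ℝ (mgf id ν) univ := by
  have huniv : integrableExpSet id ν = univ := eq_univ_of_forall h
  simpa [huniv] using analyticOnNhd_mgf (X := id) (μ := ν)

theorem measure_eq_of_mgf_id_eq {ν₁ ν₂ : Measure ℝ} [IsFiniteMeasure ν₁] [IsFiniteMeasure ν₂]
    (h : ∀ α, Integrable (fun x : ℝ => Real.exp (α * x)) ν₁) (heq : mgf id ν₁ = mgf id ν₂) :
    ν₁ = ν₂ := by
  have huniv : integrableExpSet id ν₁ = univ := eq_univ_of_forall h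
  have hmass : ν₁.real univ = ν₂.real univ := by simpa only [mgf_zero'] using congrFun heq 0
  have hzero : ν₁ = 0 ↔ ν₂ = 0 := by
    rw [← Measure.measure_univ_eq_zero, ← measureReal_eq_zero_iff, hmass, measureReal_eq_zero_iff,
      Measure.measure_univ_eq_zero]
  exact Measure.ext_of_complexMGF_id_eq
    (funext fun z => eqOn_complexMGF_of_mgf' heq hzero (by simp [huniv]))

theorem mgf_id_eq_of_eventuallyEq_nhdsWithin {lam : ℝ → ℝ} {θ x₀ γ t x : ℝ} {ν : Measure ℝ}
    {I : Set ℝ} (hθ : 0 ≤ θ) (ht : 0 ≤ t) (hν : ∀ α, Integrable (fun x : ℝ => Real.exp (α * x)) ν)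
    (hI : IsPreconnected I) (hI' : I.Nontrivial) (hx : x ∈ I)
    (h : mgf id ν =ᶠ[𝓝[I] x] fun α => Real.exp (α * γ) * mmInfMGF lam θ x₀ t α) :
    mgf id ν = fun α => Real.exp (α * γ) * mmInfMGF lam θ x₀ t α :=
  eq_of_analyticOnNhd_of_eventuallyEq_nhdsWithin (analyticOnNhd_mgf_id hν)
    (.mul (fun α _ => by fun_prop) (analyticOnNhd_mmInfMGF hθ ht)) hI hI' hx h

theorem IsMMInfLaw.eq_map_add_of_mgf_id_eq {lam : ℝ → ℝ} {θ t γ : ℝ} {n₀ : ℕ}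
    {P : ℝ → Measure ℕ} {ν : Measure ℝ} [IsFiniteMeasure ν] (h : IsMMInfLaw lam θ n₀ P)
    (hθ : 0 ≤ θ) (ht : 0 ≤ t) (hlam : IntervalIntegrable lam volume 0 t)
    (hν : ∀ α, Integrable (fun x : ℝ => Real.exp (α * x)) ν)
    (hmgf : mgf id ν = fun α => Real.exp (α * γ) * mmInfMGF lam θ n₀ t α) :
    ν = (P t).map (fun k : ℕ => (k : ℝ) + γ) := by
  have := h.prob t ht
  refine measure_eq_of_mgf_id_eq hν (hmgf.trans (funext fun α => ?_))
  rw [mgf_id_map (by fun_prop), mgf_add_const, h.mgf_natCast hθ ht hlam, mul_comm]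

theorem mainTheorem10_general
    (lam : ℝ → ℝ) (c μ θ q₀ γ : ℝ) (hc : 0 ≤ c) (hμ : 0 ≤ μ) (hθ : 0 < θ)
    (hlam_int : ∀ T, 0 ≤ T → IntervalIntegrable lam volume 0 T)
    (hlam : ∃ l : ℝ, c * μ < l ∧ ∀ᵐ t, 0 ≤ t → l ≤ lam t)
    (hq : c < q₀) (hγ : γ = c * (θ - μ) / θ) :
    IsMMInfMGF lam θ (q₀ - γ) (mmInfMGF lam θ (q₀ - γ)) ∧
    (∀ N', IsMMInfMGF lam θ (q₀ - γ) N' →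
      ∀ t, 0 ≤ t → ∀ α, N' t α = mmInfMGF lam θ (q₀ - γ) t α) ∧
    (∀ n₀ : ℕ, (n₀ : ℝ) = q₀ - γ → ∀ P, IsMMInfLaw lam θ n₀ P → ∀ t, 0 ≤ t → ∀ α,
      Integrable (fun k : ℕ => Real.exp (α * (k : ℝ))) (P t) ∧
      mgf (fun k : ℕ => (k : ℝ)) (P t) α = mmInfMGF lam θ (q₀ - γ) t α) ∧
    (∃ δ : ℝ, 0 < δ ∧
      IsFluidMGF lam c μ θ q₀ (Ioi (-δ))
        (fun t α => Real.exp (α * γ) * mmInfMGF lam θ (q₀ - γ) t α) ∧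
      ∀ (I : Set ℝ) (M : ℝ → ℝ → ℝ), I.OrdConnected → (0 : ℝ) ∈ I →
        IsFluidMGF lam c μ θ q₀ I M → ∀ t, 0 ≤ t → ∀ α ∈ I, -δ < α →
        M t α = Real.exp (α * γ) * mmInfMGF lam θ (q₀ - γ) t α) ∧
    (∀ (I : Set ℝ) (ν : ℝ → Measure ℝ), I.OrdConnected → I.Nontrivial → (0 : ℝ) ∈ I →
      (∀ t, 0 ≤ t → IsProbabilityMeasure (ν t) ∧
        ∀ α, Integrable (fun x : ℝ => Real.exp (α * x)) (ν t)) →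
      IsFluidMGF lam c μ θ q₀ I (fun t α => mgf id (ν t) α) →
      (∀ t, 0 ≤ t → ∀ α,
        mgf id (ν t) α = Real.exp (α * γ) * mmInfMGF lam θ (q₀ - γ) t α) ∧
      (∀ n₀ : ℕ, (n₀ : ℝ) = q₀ - γ → ∀ P, IsMMInfLaw lam θ n₀ P →
        ∀ t, 0 ≤ t → ν t = (P t).map (fun k : ℕ => (k : ℝ) + γ))) := by
  obtain ⟨l, hcl, hl⟩ := hlam
  have hN := isMMInfMGF_mmInfMGF (x₀ := q₀ - γ) hθ.le hlam_int
  obtain ⟨δ, hδ, hfluid⟩ := exists_isFluidMGF_exp_mul_mmInfMGF hc hμ hθ hlam_int hcl hl hq hγ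
  have huniq : ∀ (I : Set ℝ) (M : ℝ → ℝ → ℝ), I.OrdConnected → (0 : ℝ) ∈ I →
      IsFluidMGF lam c μ θ q₀ I M → ∀ t, 0 ≤ t → ∀ α ∈ I, -δ < α →
      M t α = Real.exp (α * γ) * mmInfMGF lam θ (q₀ - γ) t α :=
    fun I M hI hI0 hM t ht α hαI hα => hM.eq_of_ordConnected hμ hθ.le (hlam_int t ht) hfluid hI
      ordConnected_Ioi hI0 (neg_lt_zero.2 hδ) ht ⟨hαI, hα⟩
  refine ⟨hN, fun N' hN' t ht => congrFun (hN'.unique hθ.le (hlam_int t ht) hN ht),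
    fun n₀ hn P hP t ht α => ?_, ⟨δ, hδ, hfluid, huniq⟩, fun I ν hI hI' hI0 hν hM => ?_⟩
  · exact ⟨hP.integrable_exp hθ.le ht (hlam_int t ht) α,
      hn ▸ congrFun (hP.mgf_natCast hθ.le ht (hlam_int t ht)) α⟩
  · have hmgf : ∀ t, 0 ≤ t →
        mgf id (ν t) = fun α => Real.exp (α * γ) * mmInfMGF lam θ (q₀ - γ) t α := fun t ht =>
      mgf_id_eq_of_eventuallyEq_nhdsWithin hθ.le ht (hν t ht).2 hI.isPreconnected hI' hI0 <|
        mem_nhdsWithin.2 ⟨Ioi (-δ), isOpen_Ioi, neg_lt_zero.2 hδ,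
          fun α hα => huniq I _ hI hI0 hM t ht α hα.2 hα.1⟩
    refine ⟨fun t ht => congrFun (hmgf t ht), fun n₀ hn P hP t ht => ?_⟩
    have := (hν t ht).1
    exact hP.eq_map_add_of_mgf_id_eq hθ.le ht (hlam_int t ht) (hν t ht).2 (hn ▸ hmgf t ht)

theorem mainTheorem10
    (lam : ℝ → ℝ) (c : ℕ) (μ θ q₀ γ : ℝ)
    (hc : 0 < c) (hμ : 0 < μ) (hθ : 0 < θ)
    (hlam_int : ∀ T, 0 ≤ T → IntervalIntegrable lam volume 0 T)
    (hlam : ∃ l : ℝ, (c : ℝ) * μ < l ∧ ∀ t, 0 ≤ t → l ≤ lam t)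
    (hq : (c : ℝ) < q₀)
    (hγ : γ = (c : ℝ) * (θ - μ) / θ) :
    ∃ N : ℝ → ℝ → ℝ,
      -- `N` is the MGF of the `M/M/∞` queue with initial value `q₀ - γ`
      IsMMInfMGF lam θ (q₀ - γ) N ∧
      (∀ N', IsMMInfMGF lam θ (q₀ - γ) N' → ∀ t, 0 ≤ t → ∀ α, N' t α = N t α) ∧
      (∀ n₀ : ℕ, (n₀ : ℝ) = q₀ - γ → ∀ P, IsMMInfLaw lam θ n₀ P →
        ∀ t, 0 ≤ t → ∀ α,
          Integrable (fun k : ℕ => Real.exp (α * (k : ℝ))) (P t) ∧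
          mgf (fun k : ℕ => (k : ℝ)) (P t) α = N t α) ∧
      -- the fluid MGF exists, is unique, and equals the MGF of that queue shifted by `γ`
      (∃ δ : ℝ, 0 < δ ∧
        IsFluidMGF lam c μ θ q₀ (Ioi (-δ)) (fun t α => Real.exp (α * γ) * N t α) ∧
        ∀ (I : Set ℝ) (M : ℝ → ℝ → ℝ), I.OrdConnected → (0 : ℝ) ∈ I →
          IsFluidMGF lam c μ θ q₀ I M →
          ∀ t, 0 ≤ t → ∀ α ∈ I, -δ < α → M t α = Real.exp (α * γ) * N t α) ∧
      -- if the fluid MGF is the MGF of random variables with laws `ν t`: equality for all real `α`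
      (∀ (I : Set ℝ) (ν : ℝ → Measure ℝ), I.OrdConnected → I.Nontrivial → (0 : ℝ) ∈ I →
        (∀ t, 0 ≤ t → IsProbabilityMeasure (ν t) ∧
          ∀ α, Integrable (fun x : ℝ => Real.exp (α * x)) (ν t)) →
        IsFluidMGF lam c μ θ q₀ I (fun t α => mgf id (ν t) α) →
        (∀ t, 0 ≤ t → ∀ α, mgf id (ν t) α = Real.exp (α * γ) * N t α) ∧
        (∀ n₀ : ℕ, (n₀ : ℝ) = q₀ - γ → ∀ P, IsMMInfLaw lam θ n₀ P →
          ∀ t, 0 ≤ t → ν t = (P t).map (fun k : ℕ => (k : ℝ) + γ))) :=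
  ⟨mmInfMGF lam θ (q₀ - γ), mainTheorem10_general lam c μ θ q₀ γ c.cast_nonneg hμ.le hθ hlam_int
    (hlam.imp fun _ h => ⟨h.1, .of_forall h.2⟩) hq hγ⟩
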